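/- Let $A:[0,1]^2\to\mathbb{R}$ be continuous and $\beta\in\mathbb{R}$. On $C([0,1])$ (real-valued continuous functions) consider the operators $$\mathcal L_\beta\varphi(y)=\int_0^1 e^{\beta A(x,y)}\varphi(x)\,dx,\qquad \bar{\mathcal L}_\beta\varphi(x)=\int_0^1 e^{\beta A(x,y)}\varphi(y)\,dy .$$ There are a unique number $\lambda_\beta>0$ and unique strictly positive functions $\varphi_\beta,\bar\varphi_\beta\in C([0,1])$ with $\int\varphi_\beta\,dx=\int\bar\varphi_\beta\,dx=1$ such that $\lambda_\beta$ is the maximal eigenvalue of both $\mathcal L_\beta$ and $\bar{\mathcal L}_\beta$ (every other point $\mu$ of the real spectrum has $|\mu|<\lambda_\beta$), $\mathcal L_\beta\varphi_\beta=\lambda_\beta\varphi_\beta$ and $\bar{\mathcal L}_\beta\bar\varphi_\beta=\lambda_\beta\bar\varphi_\beta$. Put $$\theta_\beta(x)=\frac{\varphi_\beta(x)\bar\varphi_\beta(x)}{\int\varphi_\beta\bar\varphi_\beta\,dz},\qquad K_\beta(x,y)=\frac{e^{\beta A(x,y)}\bar\varphi_\beta(y)}{\bar\varphi_\beta(x)\lambda_\beta},\qquad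 d\nu_\beta(x,y)=\theta_\beta(x)K_\beta(x,y)\,dx\,dy .$$ Let $\mathbf M$ be the set of Borel probability measures $\nu$ on $[0,1]^2$ of the form $d\nu(x,y)=d\theta(x)\,dP_x(y)$, where $P$ is a transition probability on $[0,1]$ and $\theta$ is a probability measure stationary for $P$, i.e. $\theta(B)=\int P_x(B)\,d\theta(x)$ for all Borel $B$. Let $\mathbf M_{ac}$ be the set of $\nu\in\mathbf M$ that can be disintegrated as $d\nu(x,y)=\theta(x)\,dx\;K(x,y)\,dy$ with a continuous density $\theta\ge 0$ and a measurable $K\ge 0$ such that for every $x$ the function $K(x,\cdot)$ is a continuous probability density. For a probability measure $\nu$ on $[0,1]^2$ with density $\nu(x,y)$ with respect to Lebesgue measure define the penalized entropy $$S[\nu]=-\int \nu(x,y)\log\left(\frac{\nu(x,y)}{\int\nu(x,z)\,dz}\right)dx\,dy\in[-\infty,\infty).$$ For every $\nu\in\mathbf M_{ac}$ with disintegration $\theta(x)\,dx\,K(x,y)\,dy$ as above, $S[\nu]=-\int\theta(x)K(x,y)\log K(x,y)\,dx\,dy$. The measure $\nu_\beta$ belongs to $\mathbf M_{ac}$, with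 densities $\theta_\beta$ and $K_\beta$, where $K_\beta$ is continuous on $[0,1]^2$; it maximizes $$\int\beta A\,d\nu+S[\nu]$$ over all $\nu\in\mathbf M_{ac}$, and $$\int \beta A\,d\nu_\beta+S[\nu_\beta]=\log\lambda_\beta .$$ -/

import Mathlib

open MeasureTheory ProbabilityTheory
open scoped unitInterval

noncomputable section

/-! ### Integral operators on `C([0,1])` -/

/-- The function `y ↦ ∫ k(x,y) φ(x) dx` is continuous. -/
theorem continuous_kernelIntegral (k : C(I × I, ℝ)) (φ : C(I, ℝ)) :
    Continuous fun y : I => ∫ x : I, k (x, y) * φ x := by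
  have h := continuous_parametric_integral_of_continuous (μ := (volume : Measure I))
    (f := fun (y x : I) => k (x, y) * φ x) (by fun_prop) (s := Set.univ) isCompact_univ
  simpa using h

theorem integrable_of_continuous_unitInterval {f : I → ℝ} (hf : Continuous f) :
    Integrable f := by
  have h := hf.continuousOn.integrableOn_compact (μ := (volume : Measure I)) isCompact_univ
  simpa using h

/-- The integral operator on `C([0,1])` with kernel `k`: `(T φ)(y) = ∫ k(x,y) φ(x) dx`. -/
def integralOperator (k : C(I × I, ℝ)) : C(I, ℝ) →L[ℝ] C(I, ℝ) :=
  LinearMap.mkContinuous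
    { toFun := fun φ => ⟨fun y => ∫ x : I, k (x, y) * φ x, continuous_kernelIntegral k φ⟩
      map_add' := by
        intro φ ψ
        ext y
        simp only [ContinuousMap.coe_mk, ContinuousMap.add_apply, mul_add]
        exact integral_add (integrable_of_continuous_unitInterval (by fun_prop))
          (integrable_of_continuous_unitInterval (by fun_prop))
      map_smul' := by
        intro c φ
        ext y
        simp only [ContinuousMap.coe_mk, ContinuousMap.smul_apply, smul_eq_mul, RingHom.id_apply]
        rw [← integral_const_mul]
        congr 1
        ext x
        ring }
    ‖k‖
    (by
      intro φ
      rw [ContinuousMap.norm_le _ (by positivity)]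
      intro y
      have h : ∀ x : I, ‖k (x, y) * φ x‖ ≤ ‖k‖ * ‖φ‖ := fun x => by
        rw [norm_mul]
        exact mul_le_mul (k.norm_coe_le_norm _) (φ.norm_coe_le_norm _) (norm_nonneg _)
          (norm_nonneg _)
      simpa using norm_integral_le_of_norm_le_const (μ := (volume : Measure I))
        (Filter.Eventually.of_forall h))

/-- The kernel `e^{β A(x,y)}`. -/
def gibbsKernel (A : C(I × I, ℝ)) (β : ℝ) : C(I × I, ℝ) :=
  ⟨fun p => Real.exp (β * A p), by fun_prop⟩

/-- The operator `(L_β φ)(y) = ∫ e^{β A(x,y)} φ(x) dx`. -/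
def perronOp (A : C(I × I, ℝ)) (β : ℝ) : C(I, ℝ) →L[ℝ] C(I, ℝ) :=
  integralOperator (gibbsKernel A β)

/-- The operator `(L̄_β φ)(x) = ∫ e^{β A(x,y)} φ(y) dy`. -/
def perronOpBar (A : C(I × I, ℝ)) (β : ℝ) : C(I, ℝ) →L[ℝ] C(I, ℝ) :=
  integralOperator ((gibbsKernel A β).comp ⟨Prod.swap, continuous_swap⟩)

theorem perronOp_apply (A : C(I × I, ℝ)) (β : ℝ) (φ : C(I, ℝ)) (y : I) :
    perronOp A β φ y = ∫ x : I, Real.exp (β * A (x, y)) * φ x := rfl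

theorem perronOpBar_apply (A : C(I × I, ℝ)) (β : ℝ) (φ : C(I, ℝ)) (x : I) :
    perronOpBar A β φ x = ∫ y : I, Real.exp (β * A (x, y)) * φ y := rfl

/-- `lam` is a positive maximal eigenvalue of `T`: it is a positive eigenvalue, and every other
point of the spectrum has strictly smaller absolute value. -/
structure IsMaximalEigenvalue (T : C(I, ℝ) →L[ℝ] C(I, ℝ)) (lam : ℝ) : Prop where
  pos : 0 < lam
  hasEigenvalue : Module.End.HasEigenvalue (T : Module.End ℝ C(I, ℝ)) lam
  abs_lt : ∀ μ ∈ spectrum ℝ T, μ ≠ lam → |μ| < lam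

/-- `φ` is a positive eigenfunction of `T` for the eigenvalue `lam`, normalized by `∫ φ = 1`. -/
structure IsNormalizedPositiveEigenfunction (T : C(I, ℝ) →L[ℝ] C(I, ℝ)) (lam : ℝ)
    (φ : C(I, ℝ)) : Prop where
  eigen : T φ = lam • φ
  pos : ∀ x, 0 < φ x
  integral_eq_one : ∫ x : I, φ x = 1

/-- `lam = λ_β` is the common maximal eigenvalue of `L_β` and `L̄_β`, and `φ = φ_β`, `ψ = φ̄_β`
are the corresponding normalized positive eigenfunctions. -/
structure IsPerronData (A : C(I × I, ℝ)) (β lam : ℝ) (φ ψ : C(I, ℝ)) : Prop where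
  maximal : IsMaximalEigenvalue (perronOp A β) lam
  maximal_bar : IsMaximalEigenvalue (perronOpBar A β) lam
  eigenfunction : IsNormalizedPositiveEigenfunction (perronOp A β) lam φ
  eigenfunction_bar : IsNormalizedPositiveEigenfunction (perronOpBar A β) lam ψ

/-! ### The measure `ν_β` -/

/-- `θ_β(x) = φ(x) φ̄(x) / π_β`, where `π_β = ∫ φ φ̄`. -/
def thetaBeta (φ ψ : C(I, ℝ)) (x : I) : ℝ :=
  φ x * ψ x / ∫ z : I, φ z * ψ z

/-- `K_β(x,y) = e^{β A(x,y)} φ̄(y) / (φ̄(x) λ_β)`. -/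
def kBeta (A : C(I × I, ℝ)) (β lam : ℝ) (ψ : C(I, ℝ)) (x y : I) : ℝ :=
  Real.exp (β * A (x, y)) * ψ y / (ψ x * lam)

/-- `dν_β(x,y) = θ_β(x) K_β(x,y) dx dy`. -/
def nuBeta (A : C(I × I, ℝ)) (β lam : ℝ) (φ ψ : C(I, ℝ)) : Measure (I × I) :=
  volume.withDensity fun p => ENNReal.ofReal (thetaBeta φ ψ p.1 * kBeta A β lam ψ p.1 p.2)

/-! ### Induced stationary Markov measures -/

/-- The set `M` of induced stationary Markov measures: `dν(x,y) = dθ(x) dP_x(y)` with `θ` a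
probability measure stationary for the transition probability `P`. -/
def inducedMarkov : Set (Measure (I × I)) :=
  {ν | ∃ (θ : Measure I) (P : Kernel I I), IsProbabilityMeasure θ ∧ IsMarkovKernel P ∧
    (∀ B : Set I, MeasurableSet B → θ B = ∫⁻ x, P x B ∂θ) ∧ ν = θ.compProd P}

/-- `ν` is disintegrated as `θ(x) dx · K(x,y) dy` with a continuous density `θ` and, for each `x`,
a continuous probability density `K(x,·)`. -/
structure IsContinuousDisintegration (ν : Measure (I × I)) (θ : I → ℝ) (K : I → I → ℝ) :
    Prop where
  theta_continuous : Continuous θ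
  theta_nonneg : ∀ x, 0 ≤ θ x
  k_measurable : Measurable (Function.uncurry K)
  k_continuous : ∀ x, Continuous (K x)
  k_nonneg : ∀ x y, 0 ≤ K x y
  disintegration : ∃ P : Kernel I I, IsMarkovKernel P ∧
    (∀ x, P x = volume.withDensity fun y => ENNReal.ofReal (K x y)) ∧
    ν = (volume.withDensity fun x => ENNReal.ofReal (θ x)).compProd P

/-- The set `M_ac` of induced absolutely continuous stationary Markov measures. -/
def inducedMarkovAC : Set (Measure (I × I)) :=
  {ν | ν ∈ inducedMarkov ∧ ∃ (θ : I → ℝ) (K : I → I → ℝ), IsContinuousDisintegration ν θ K}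

/-! ### Entropy -/

/-- The integral of a real function over the square as an extended real number, `∫ f⁺ - ∫ f⁻`
(meaningful if one of the two is finite). -/
def extendedIntegral (f : I × I → ℝ) : EReal :=
  ((∫⁻ p, ENNReal.ofReal (f p) : ENNReal) : EReal) -
    ((∫⁻ p, ENNReal.ofReal (-f p) : ENNReal) : EReal)

/-- The density of an absolutely continuous `ν` with respect to Lebesgue measure. -/
def densityOf (ν : Measure (I × I)) (p : I × I) : ℝ :=
  (ν.rnDeriv volume p).toReal

/-- The entropy term `S[ν] = - ∫ ν(x,y) log (ν(x,y) / ∫ ν(x,z) dz) dx dy` of an absolutely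
continuous probability measure with density `ν(x,y)`. As `t log t ≥ -1/e`, the integral is
well defined in `(-∞, +∞]`. -/
def entropyTerm (ν : Measure (I × I)) : EReal :=
  -extendedIntegral fun p =>
    densityOf ν p * Real.log (densityOf ν p / ∫ z : I, densityOf ν (p.1, z))

/-- The functional `∫ β A dν + S[ν]`. -/
def penalizedFunctional (A : C(I × I, ℝ)) (β : ℝ) (ν : Measure (I × I)) : EReal :=
  ((∫ p, β * A p ∂ν : ℝ) : EReal) + entropyTerm ν

end

/-! Two independent arguments meet here. Perron theory for a positive continuous kernel: the largest
`t` with `t f ≤ T f` for some normalized `f ≥ 0` is attained by compactness, and strict positivity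
of `T` forces equality (`exists_positive_eigenfunction`). Pairing with an eigenfunction of the
transposed kernel shows that both operators have the same eigenvalue (`eigenvalue_eq_of_dual`).
Subtracting from the kernel a small multiple of `φ(y) ψ(x)` keeps it nonnegative but lowers the
eigenvalue of `φ`, which yields the spectral gap without leaving the real spectrum
(`abs_lt_of_mem_spectrum`). Variational part: `log K_β` is `β A - log λ` plus the coboundary `log
ψ(y) - log ψ(x)`, which every stationary measure integrates to zero (`integral_log_kBeta`). So `∫ β
A dν - log λ = ∫ log K_β dν`, and the bound is Gibbs' inequality `∫ θ K log K_β ≤ ∫ θ K log K`, an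
equality at `K = K_β`. -/

theorem integralOperator_apply (k : C(I × I, ℝ)) (f : C(I, ℝ)) (y : I) :
    integralOperator k f y = ∫ x : I, k (x, y) * f x := rfl

/-! ### Strict positivity of integrals and integral operators -/

instance unitInterval_isOpenPosMeasure : (volume : Measure I).IsOpenPosMeasure where
  open_pos := by
    rintro U hU ⟨x, hx⟩
    obtain ⟨V, hV, rfl⟩ := isOpen_induced_iff.1 hU
    rw [unitInterval.measurePreserving_coe.measure_preimage hV.measurableSet.nullMeasurableSet,
      Measure.restrict_apply hV.measurableSet]
    have hx' : (x : ℝ) ∈ closure (Set.Ioo (0 : ℝ) 1) := by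
      rw [closure_Ioo zero_ne_one]
      exact x.2
    obtain ⟨y, hyV, hy⟩ := mem_closure_iff.1 hx' V hV hx
    exact ((hV.inter isOpen_Ioo).measure_pos volume ⟨y, hyV, hy⟩).trans_le
      (measure_mono (Set.inter_subset_inter_right V Set.Ioo_subset_Icc_self)) |>.ne'

theorem unitInterval_integral_pos {f : I → ℝ} (hf : Continuous f) (h0 : ∀ x, 0 ≤ f x) {a : I}
    (ha : 0 < f a) : 0 < ∫ x : I, f x :=
  hf.integral_pos_of_hasCompactSupport_nonneg_nonzero (.of_compactSpace f) h0 ha.ne'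

theorem integralOperator_nonneg {k : C(I × I, ℝ)} (hk : ∀ p, 0 ≤ k p) {f : C(I, ℝ)}
    (hf : ∀ x, 0 ≤ f x) (y : I) : 0 ≤ integralOperator k f y :=
  integral_nonneg fun x => mul_nonneg (hk _) (hf x)

theorem integralOperator_mono {k : C(I × I, ℝ)} (hk : ∀ p, 0 ≤ k p) {f g : C(I, ℝ)}
    (hfg : ∀ x, f x ≤ g x) (y : I) : integralOperator k f y ≤ integralOperator k g y := by
  have h := integralOperator_nonneg hk (f := g - f) (fun x => by simpa using hfg x) y
  rw [map_sub] at h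
  simpa using h

theorem integralOperator_pos {k : C(I × I, ℝ)} (hk : ∀ p, 0 < k p) {f : C(I, ℝ)}
    (hf : ∀ x, 0 ≤ f x) (hf0 : f ≠ 0) (y : I) : 0 < integralOperator k f y := by
  obtain ⟨a, ha⟩ : ∃ a, f a ≠ 0 := by
    by_contra! h
    exact hf0 (ContinuousMap.ext h)
  exact unitInterval_integral_pos (by fun_prop) (fun x => mul_nonneg (hk _).le (hf x))
    (mul_pos (hk _) (lt_of_le_of_ne (hf a) ha.symm))

theorem exists_pos_forall_le {X : Type*} [TopologicalSpace X] [CompactSpace X] (f : C(X, ℝ))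
    (hf : ∀ x, 0 < f x) : ∃ m > 0, ∀ x, m ≤ f x := by
  rcases isEmpty_or_nonempty X with hX | hX
  · exact ⟨1, one_pos, fun x => (hX.false x).elim⟩
  · obtain ⟨a, ha⟩ := f.continuous.exists_forall_le_of_hasCompactSupport (.of_compactSpace f)
    exact ⟨f a, hf a, ha⟩

/-! ### Compactness -/

theorem equicontinuous_integralOperator (k : C(I × I, ℝ)) :
    Equicontinuous fun (f : Metric.closedBall (0 : C(I, ℝ)) 1) (y : I) =>
      integralOperator k f y := by
  intro y₀
  rw [Metric.equicontinuousAt_iff_right]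
  intro ε hε
  -- Currying to `y ↦ k(·, y)`, continuous for the sup norm, gives a modulus of continuity that does
  -- not depend on `f`.
  let κ : C(I, C(I, ℝ)) := (k.comp ⟨Prod.swap, continuous_swap⟩).curry
  have hκ := κ.continuous.tendsto y₀
  filter_upwards [Metric.tendsto_nhds.1 hκ ε hε] with y hy f
  have hf : ‖(f : C(I, ℝ))‖ ≤ 1 := mem_closedBall_zero_iff.1 f.2
  refine lt_of_le_of_lt ?_ hy
  rw [dist_comm, dist_eq_norm, dist_eq_norm, integralOperator_apply, integralOperator_apply,
    ← integral_sub (integrable_of_continuous_unitInterval (by fun_prop))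
      (integrable_of_continuous_unitInterval (by fun_prop))]
  have h : ∀ x : I, ‖k (x, y) * (f : C(I, ℝ)) x - k (x, y₀) * (f : C(I, ℝ)) x‖
      ≤ ‖κ y - κ y₀‖ := fun x => by
    rw [← sub_mul, norm_mul]
    calc _ ≤ ‖κ y - κ y₀‖ * 1 :=
          mul_le_mul ((κ y - κ y₀).norm_coe_le_norm x)
            (((f : C(I, ℝ)).norm_coe_le_norm x).trans hf) (norm_nonneg _) (norm_nonneg _)
      _ = _ := mul_one _
  simpa using norm_integral_le_of_norm_le_const (μ := (volume : Measure I))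
    (Filter.Eventually.of_forall h)

/-- Arzelà–Ascoli, applied to bounded continuous functions and carried back along the isometry with
`C(I, ℝ)`. -/
theorem exists_isCompact_integralOperator_mem (k : C(I × I, ℝ)) :
    ∃ C : Set C(I, ℝ), IsCompact C ∧ ∀ f : C(I, ℝ), ‖f‖ ≤ 1 → integralOperator k f ∈ C := by
  let e := ContinuousMap.isometryEquivBoundedOfCompact I ℝ
  let S := (fun f => e (integralOperator k f)) '' Metric.closedBall 0 1
  have hS : IsCompact (closure S) := by
    refine BoundedContinuousFunction.arzela_ascoli (Metric.closedBall 0 ‖integralOperator k‖)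
      (isCompact_closedBall _ _) S ?_ ?_
    · rintro _ x ⟨f, hf, rfl⟩
      have hf : ‖f‖ ≤ 1 := by simpa using hf
      simp only [mem_closedBall_zero_iff]
      calc ‖integralOperator k f x‖ ≤ ‖integralOperator k f‖ := ContinuousMap.norm_coe_le_norm _ x
        _ ≤ ‖integralOperator k‖ * ‖f‖ := ContinuousLinearMap.le_opNorm _ _
        _ ≤ _ := mul_le_of_le_one_right (integralOperator k).opNorm_nonneg hf
    · have h := equicontinuous_integralOperator k
      intro x U hU
      filter_upwards [h x U hU] with y hy
      rintro ⟨_, f, hf, rfl⟩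
      exact hy ⟨f, hf⟩
  refine ⟨e.symm '' closure S, hS.image e.symm.continuous, fun f hf => ?_⟩
  exact ⟨e (integralOperator k f), subset_closure ⟨f, by simpa using hf, rfl⟩, by simp⟩

/-! ### Existence of a positive eigenfunction -/

/-- The numbers `t` for which some normalized nonnegative `f` satisfies `t f ≤ T f`. -/
def subeigenvalues (T : C(I, ℝ) →L[ℝ] C(I, ℝ)) : Set ℝ :=
  {t | ∃ f : C(I, ℝ), (∀ x, 0 ≤ f x) ∧ ‖f‖ = 1 ∧ ∀ x, t * f x ≤ T f x}

theorem mem_subeigenvalues {T : C(I, ℝ) →L[ℝ] C(I, ℝ)} {t : ℝ} {f : C(I, ℝ)}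
    (hf : ∀ x, 0 ≤ f x) (hf0 : f ≠ 0) (h : ∀ x, t * f x ≤ T f x) : t ∈ subeigenvalues T := by
  refine ⟨‖f‖⁻¹ • f, fun x => ?_, ?_, fun x => ?_⟩
  · exact mul_nonneg (by positivity) (hf x)
  · rw [norm_smul, norm_inv, norm_norm, inv_mul_cancel₀ (norm_ne_zero_iff.2 hf0)]
  · rw [map_smul, ContinuousMap.smul_apply, ContinuousMap.smul_apply, smul_eq_mul, smul_eq_mul,
      mul_left_comm]
    exact mul_le_mul_of_nonneg_left (h x) (by positivity)

theorem le_norm_apply_of_le {f g : C(I, ℝ)} {t : ℝ} (ht : 0 ≤ t) (hf : ∀ x, 0 ≤ f x)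
    (h : ∀ x, t * f x ≤ g x) : t * ‖f‖ ≤ ‖g‖ := by
  have : ‖t • f‖ ≤ ‖g‖ := by
    rw [ContinuousMap.norm_le _ (norm_nonneg _)]
    intro x
    rw [ContinuousMap.smul_apply, smul_eq_mul, Real.norm_of_nonneg (mul_nonneg ht (hf x))]
    exact (h x).trans ((le_abs_self _).trans (g.norm_coe_le_norm x))
  rwa [norm_smul, Real.norm_of_nonneg ht] at this

theorem bddAbove_subeigenvalues (T : C(I, ℝ) →L[ℝ] C(I, ℝ)) : BddAbove (subeigenvalues T) := by
  refine ⟨‖T‖, ?_⟩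
  rintro t ⟨f, hf, hf1, h⟩
  rcases le_total t 0 with ht | ht
  · exact ht.trans T.opNorm_nonneg
  · simpa [hf1] using (le_norm_apply_of_le ht hf h).trans (T.le_opNorm f)

theorem exists_pos_mem_subeigenvalues {k : C(I × I, ℝ)} (hk : ∀ p, 0 < k p) :
    ∃ t > 0, t ∈ subeigenvalues (integralOperator k) := by
  have h1 : ∀ x, 0 < integralOperator k 1 x :=
    integralOperator_pos hk (by simp) one_ne_zero
  obtain ⟨m, hm, h⟩ := exists_pos_forall_le _ h1
  exact ⟨m, hm, mem_subeigenvalues (f := 1) (by simp) one_ne_zero (by simpa using h)⟩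

/-- Collatz–Wielandt: the supremum of `subeigenvalues` is the eigenvalue, and a limit of the images
`T fₙ` of almost optimal `fₙ` is the eigenfunction. -/
theorem exists_positive_eigenfunction {k : C(I × I, ℝ)} (hk : ∀ p, 0 < k p) :
    ∃ lam > 0, ∃ φ, IsNormalizedPositiveEigenfunction (integralOperator k) lam φ := by
  set T := integralOperator k with hT
  obtain ⟨t₀, ht₀, ht₀S⟩ := exists_pos_mem_subeigenvalues hk
  have hbdd := bddAbove_subeigenvalues T
  set lam := sSup (subeigenvalues T) with hlam
  have hlam0 : 0 < lam := ht₀.trans_le (le_csSup hbdd ht₀S)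
  obtain ⟨t, -, ht, htS⟩ := exists_seq_tendsto_sSup ⟨t₀, ht₀S⟩ hbdd
  choose f hf hf1 hft using htS
  obtain ⟨C, hC, hTC⟩ := exists_isCompact_integralOperator_mem k
  obtain ⟨g, -, s, hs, hg⟩ := hC.tendsto_subseq fun n => hTC (f n) (hf1 n).le
  have hts := ht.comp hs.tendsto_atTop
  have heval : ∀ x, Continuous fun u : C(I, ℝ) => u x := fun x => by fun_prop
  have hg0 : ∀ x, 0 ≤ g x := fun x =>
    ge_of_tendsto' (((heval x).tendsto g).comp hg) fun n =>
      integralOperator_nonneg (fun p => (hk p).le) (hf _) x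
  -- `t f ≤ T f` with `‖f‖ = 1` gives `‖T f‖ ≥ t`, so the images cannot shrink to zero.
  have hgne : g ≠ 0 := by
    have h : lam ≤ ‖g‖ := by
      refine le_of_tendsto_of_tendsto hts hg.norm ?_
      filter_upwards [hts.eventually (lt_mem_nhds hlam0)] with n hn
      simpa [hf1] using le_norm_apply_of_le hn.le (hf _) (hft (s n))
    exact norm_pos_iff.1 (hlam0.trans_le h)
  have hTg : ∀ x, lam * g x ≤ T g x := fun x => by
    refine le_of_tendsto_of_tendsto' (hts.mul (((heval x).tendsto g).comp hg))
      ((((heval x).comp T.continuous).tendsto g).comp hg) fun n => ?_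
    -- Applying `T` to `t f ≤ T f` transfers the inequality to `T f`, the sequence that converges.
    have h := integralOperator_mono (fun p => (hk p).le) (f := t (s n) • f (s n)) (hft (s n)) x
    rwa [map_smul] at h
  have heig : T g = lam • g := by
    by_contra hne
    have h0 : ∀ x, 0 ≤ (T g - lam • g) x := fun x => by simpa using hTg x
    have hpos := integralOperator_pos hk h0 (sub_ne_zero.2 hne)
    obtain ⟨m, hm, hle⟩ := exists_pos_forall_le _ hpos
    have hTgpos := integralOperator_pos hk hg0 hgne
    have hTgne : T g ≠ 0 := fun h => (hTgpos 0).ne' (by rw [← hT, h]; rfl)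
    have hnorm := norm_pos_iff.2 hTgne
    -- If `T g ≠ lam g`, then `T (T g) ≥ lam T g + m`, and `m ≥ (m / ‖T g‖) T g`: the function `T g`
    -- would beat the supremum.
    have : lam + m / ‖T g‖ ∈ subeigenvalues T := by
      refine mem_subeigenvalues (fun x => (hTgpos x).le) hTgne fun x => ?_
      have h1 := hle x
      rw [map_sub, map_smul] at h1
      have h2 : m / ‖T g‖ * T g x ≤ m := by
        rw [div_mul_eq_mul_div, div_le_iff₀ hnorm]
        exact mul_le_mul_of_nonneg_left
          ((le_abs_self _).trans ((T g).norm_coe_le_norm x)) hm.le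
      simp only [ContinuousMap.sub_apply, ContinuousMap.smul_apply, smul_eq_mul] at h1
      rw [add_mul]
      linarith
    have h := le_csSup hbdd this
    have : 0 < m / ‖T g‖ := by positivity
    linarith
  have hgpos : ∀ x, 0 < g x := fun x => by
    have h := integralOperator_pos hk hg0 hgne x
    rw [← hT, heig] at h
    exact (mul_pos_iff_of_pos_left hlam0).1 h
  have hint : 0 < ∫ x, g x := unitInterval_integral_pos g.continuous hg0 (hgpos 0)
  refine ⟨lam, hlam0, (∫ x, g x)⁻¹ • g, ?_, fun x => mul_pos (by positivity) (hgpos x), ?_⟩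
  · rw [map_smul, heig, smul_comm]
  · simp only [ContinuousMap.smul_apply, smul_eq_mul, integral_const_mul]
    exact inv_mul_cancel₀ hint.ne'

/-! ### Duality -/

theorem integrable_of_continuous_unitSquare {f : I × I → ℝ} (hf : Continuous f) :
    Integrable f := by
  have h := hf.continuousOn.integrableOn_compact (μ := (volume : Measure (I × I))) isCompact_univ
  simpa using h

theorem integral_mul_integralOperator (k : C(I × I, ℝ)) (f g : C(I, ℝ)) :
    ∫ y : I, g y * integralOperator k f y =
      ∫ x : I, integralOperator (k.comp ⟨Prod.swap, continuous_swap⟩) g x * f x := by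
  simp only [integralOperator_apply, ← integral_const_mul, ← integral_mul_const]
  rw [integral_integral_swap (integrable_of_continuous_unitSquare (by fun_prop))]
  refine integral_congr_ae (.of_forall fun x => integral_congr_ae (.of_forall fun y => ?_))
  simp only [ContinuousMap.comp_apply, ContinuousMap.coe_mk, Prod.swap_prod_mk]
  ring

theorem integral_mul_pos {f g : C(I, ℝ)} (hf : ∀ x, 0 < f x) (hg : ∀ x, 0 < g x) :
    0 < ∫ x : I, f x * g x :=
  unitInterval_integral_pos (a := 0) (by fun_prop) (fun x => (mul_pos (hf x) (hg x)).le)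
    (mul_pos (hf 0) (hg 0))

theorem eigenvalue_eq_of_dual {k : C(I × I, ℝ)} {l l' : ℝ} {φ ψ : C(I, ℝ)}
    (hφ : integralOperator k φ = l • φ)
    (hψ : integralOperator (k.comp ⟨Prod.swap, continuous_swap⟩) ψ = l' • ψ)
    (hφ0 : ∀ x, 0 < φ x) (hψ0 : ∀ x, 0 < ψ x) : l = l' := by
  have h := integral_mul_integralOperator k φ ψ
  simp only [hφ, hψ, ContinuousMap.smul_apply, smul_eq_mul, mul_left_comm _ l, mul_assoc,
    integral_const_mul] at h
  exact mul_right_cancel₀ (integral_mul_pos hψ0 hφ0).ne' h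

/-! ### Uniqueness of the positive eigenfunction -/

/-- With `c` the minimum of `φ / φ'`, the difference `φ - c φ'` is nonnegative and vanishes
somewhere. Were it nonzero, `T` would make it strictly positive everywhere, yet `T` only multiplies
it by `lam`. -/
theorem positive_eigenfunction_unique {k : C(I × I, ℝ)} (hk : ∀ p, 0 < k p) {lam : ℝ}
    {φ φ' : C(I, ℝ)} (h : IsNormalizedPositiveEigenfunction (integralOperator k) lam φ)
    (h' : IsNormalizedPositiveEigenfunction (integralOperator k) lam φ') : φ = φ' := by
  have hc : Continuous fun x => φ x / φ' x :=
    φ.continuous.div φ'.continuous fun x => (h'.pos x).ne'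
  obtain ⟨a, ha⟩ := hc.exists_forall_le_of_hasCompactSupport (.of_compactSpace _)
  set c := φ a / φ' a
  have hle : ∀ x, 0 ≤ (φ - c • φ') x := fun x => by
    simpa using (le_div_iff₀ (h'.pos x)).1 (ha x)
  have hzero : (φ - c • φ') a = 0 := by
    have := (h'.pos a).ne'
    simp [c, this]
  have heq : φ = c • φ' := by
    by_contra hne
    have hpos := integralOperator_pos hk hle (sub_ne_zero.2 hne) a
    rw [map_sub, map_smul, h.eigen, h'.eigen, smul_comm c, ← smul_sub, ContinuousMap.smul_apply,
      hzero, smul_zero] at hpos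
    exact hpos.false
  have hc1 : c = 1 := by
    have := h.integral_eq_one
    rw [heq] at this
    simpa [integral_const_mul, h'.integral_eq_one] using this
  rw [heq, hc1, one_smul]

/-! ### Spectral gap -/

/-- With `U = μ - B`, the relations give `U R = R U = (μ - r) R`, so `(U - R)(1 + b R) = U` for `b =
1 / (μ - r - s)`, and likewise on the other side. Hence adding `R` to `B` can create only the
spectral value `r + s`. -/
theorem isUnit_sub_add_of_rank_one {E : Type*} [Ring E] [Algebra ℝ E] {B R : E} {r s μ : ℝ}
    (hBR : B * R = r • R) (hRB : R * B = r • R) (hRR : R * R = s • R)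
    (hB : IsUnit (algebraMap ℝ E μ - B)) (hμ : μ ≠ r + s) :
    IsUnit (algebraMap ℝ E μ - (B + R)) := by
  have hne : μ - r - s ≠ 0 := fun h => hμ (by linarith)
  obtain ⟨U, hU⟩ := hB
  set b := (μ - r - s)⁻¹
  have key : b * (μ - r - s) = 1 := inv_mul_cancel₀ hne
  have hUR : (U : E) * R = (μ - r) • R := by
    rw [hU, sub_mul, hBR, ← Algebra.smul_def, sub_smul]
  have hRU : R * (U : E) = (μ - r) • R := by
    rw [hU, mul_sub, hRB, ← Algebra.commutes, ← Algebra.smul_def, sub_smul]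
  have hrw : algebraMap ℝ E μ - (B + R) = U - R := by rw [hU]; abel
  have hcoef : b * (μ - r) - b * s - 1 = 0 := by linear_combination key
  have h1 : ((U : E) - R) * (1 + b • R) = U := by
    have : ((U : E) - R) * (1 + b • R) = U + (b * (μ - r) - b * s - 1) • R := by
      simp only [sub_mul, mul_add, mul_one, mul_smul_comm, hUR, hRR]
      module
    rw [this, hcoef, zero_smul, add_zero]
  have h2 : (1 + b • R) * ((U : E) - R) = U := by
    have : (1 + b • R) * ((U : E) - R) = U + (b * (μ - r) - b * s - 1) • R := by
      simp only [mul_sub, add_mul, one_mul, smul_mul_assoc, hRU, hRR]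
      module
    rw [this, hcoef, zero_smul, add_zero]
  rw [hrw]
  refine isUnit_iff_exists_and_exists.2 ⟨⟨(1 + b • R) * ↑U⁻¹, ?_⟩, ⟨↑U⁻¹ * (1 + b • R), ?_⟩⟩
  · rw [← mul_assoc, h1, U.mul_inv]
  · rw [mul_assoc, h2, U.inv_mul]

theorem le_of_forall_pow_le_mul_pow {a b C : ℝ} (hb : 0 ≤ b)
    (h : ∀ n : ℕ, a ^ n ≤ C * b ^ n) : a ≤ b := by
  rcases hb.eq_or_lt with rfl | hb
  · simpa using h 1
  · by_contra! hab
    obtain ⟨n, hn⟩ := pow_unbounded_of_one_lt C ((one_lt_div hb).2 hab)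
    rw [div_pow, lt_div_iff₀ (by positivity)] at hn
    exact (h n).not_gt hn

theorem abs_integralOperator_le {k : C(I × I, ℝ)} (hk : ∀ p, 0 ≤ k p) {l a : ℝ} {φ f : C(I, ℝ)}
    (hφ : integralOperator k φ = l • φ) (hf : ∀ x, |f x| ≤ a * φ x) (y : I) :
    |integralOperator k f y| ≤ a * l * φ y := by
  have h1 := integralOperator_mono hk (f := f) (g := a • φ)
    (fun x => (le_abs_self _).trans (hf x)) y
  have h2 := integralOperator_mono hk (f := -f) (g := a • φ)
    (fun x => (neg_le_abs _).trans (hf x)) y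
  rw [map_smul, hφ] at h1 h2
  rw [map_neg] at h2
  simp only [ContinuousMap.smul_apply, ContinuousMap.neg_apply, smul_eq_mul, ← mul_assoc] at h1 h2
  exact abs_le.2 ⟨by linarith, h1⟩

theorem abs_le_of_norm_pow_apply_le {E : Type*} [NormedAddCommGroup E] [NormedSpace ℝ E]
    [CompleteSpace E] [Nontrivial E] {T : E →L[ℝ] E} {C l μ : ℝ} (hC : 0 ≤ C) (hl : 0 ≤ l)
    (h : ∀ (n : ℕ) (f : E), ‖(T ^ n) f‖ ≤ C * l ^ n * ‖f‖) (hμ : μ ∈ spectrum ℝ T) :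
    |μ| ≤ l := by
  refine le_of_forall_pow_le_mul_pow (C := C) hl fun n => ?_
  have h1 := spectrum.norm_le_norm_of_mem (spectrum.pow_mem_pow _ n hμ)
  rw [norm_pow, Real.norm_eq_abs] at h1
  exact h1.trans (ContinuousLinearMap.opNorm_le_bound _ (by positivity) (h n))

/-- A bound `|f| ≤ a φ` becomes `|Tⁿ f| ≤ a lⁿ φ`, so `‖Tⁿ‖ ≤ C lⁿ`; as `μⁿ` lies in the spectrum of
`Tⁿ`, letting `n` grow removes `C`. -/
theorem abs_le_of_mem_spectrum {k : C(I × I, ℝ)} (hk : ∀ p, 0 ≤ k p) {l : ℝ} {φ : C(I, ℝ)}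
    (hl : 0 ≤ l) (hφ0 : ∀ x, 0 < φ x) (hφ : integralOperator k φ = l • φ) {μ : ℝ}
    (hμ : μ ∈ spectrum ℝ (integralOperator k)) : |μ| ≤ l := by
  obtain ⟨m, hm, hmφ⟩ := exists_pos_forall_le φ hφ0
  have hpow : ∀ (n : ℕ) (f : C(I, ℝ)) (x : I),
      |(integralOperator k ^ n) f x| ≤ ‖f‖ / m * l ^ n * φ x := by
    intro n f
    induction n with
    | zero =>
      intro x
      rw [pow_zero, pow_zero, mul_one, div_mul_eq_mul_div, le_div_iff₀ hm]
      exact mul_le_mul (f.norm_coe_le_norm x) (hmφ x) hm.le (norm_nonneg _)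
    | succ n ih =>
      intro x
      rw [pow_succ', pow_succ, ← mul_assoc]
      exact abs_integralOperator_le hk hφ ih x
  refine abs_le_of_norm_pow_apply_le (C := ‖φ‖ / m) (by positivity) hl (fun n f => ?_) hμ
  rw [ContinuousMap.norm_le _ (by positivity)]
  intro x
  refine (hpow n f x).trans ?_
  calc ‖f‖ / m * l ^ n * φ x ≤ ‖f‖ / m * l ^ n * ‖φ‖ :=
        mul_le_mul_of_nonneg_left ((le_abs_self _).trans (φ.norm_coe_le_norm x)) (by positivity)
    _ = _ := by ring

/-- The kernel `(x, y) ↦ c φ(y) ψ(x)` of a rank one operator. -/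
noncomputable def rankOneKernel (c : ℝ) (φ ψ : C(I, ℝ)) : C(I × I, ℝ) :=
  ⟨fun p => c * (φ p.2 * ψ p.1), by fun_prop⟩

theorem integralOperator_rankOneKernel (c : ℝ) (φ ψ f : C(I, ℝ)) :
    integralOperator (rankOneKernel c φ ψ) f = (c * ∫ x : I, ψ x * f x) • φ := by
  ext y
  rw [integralOperator_apply, ContinuousMap.smul_apply, smul_eq_mul, mul_right_comm,
    ← integral_const_mul]
  refine integral_congr_ae (.of_forall fun x => ?_)
  simp only [rankOneKernel, ContinuousMap.coe_mk]
  ring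

theorem integralOperator_add (k k' : C(I × I, ℝ)) :
    integralOperator (k + k') = integralOperator k + integralOperator k' := by
  ext f y
  simp only [add_apply, ContinuousMap.add_apply, integralOperator_apply,
    add_mul]
  exact integral_add (integrable_of_continuous_unitInterval (by fun_prop))
    (integrable_of_continuous_unitInterval (by fun_prop))

theorem abs_lt_of_mem_spectrum {k : C(I × I, ℝ)} (hk : ∀ p, 0 < k p) {lam : ℝ} {φ ψ : C(I, ℝ)}
    (hφ0 : ∀ x, 0 < φ x) (hψ0 : ∀ x, 0 < ψ x) (hφ : integralOperator k φ = lam • φ)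
    (hψ : integralOperator (k.comp ⟨Prod.swap, continuous_swap⟩) ψ = lam • ψ) {μ : ℝ}
    (hμ : μ ∈ spectrum ℝ (integralOperator k)) (hne : μ ≠ lam) : |μ| < lam := by
  obtain ⟨m, hm, hmk⟩ := exists_pos_forall_le k hk
  have hnorm : ∀ {f : C(I, ℝ)}, (∀ x, 0 < f x) → 0 < ‖f‖ := fun {f} hf =>
    (hf 0).trans_le ((le_abs_self _).trans (f.norm_coe_le_norm 0))
  have hnφ := hnorm hφ0
  have hnψ := hnorm hψ0
  -- Chosen so that `c φ(y) ψ(x) ≤ m ≤ k(x, y)`, which leaves the kernel of `B` nonnegative.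
  set c := m / (‖φ‖ * ‖ψ‖) with hc
  have hc0 : 0 < c := by positivity
  set s := c * ∫ x : I, ψ x * φ x with hs
  have hs0 : 0 < s := mul_pos hc0 (integral_mul_pos hψ0 hφ0)
  set R := integralOperator (rankOneKernel c φ ψ) with hR
  set B := integralOperator (k - rankOneKernel c φ ψ) with hB
  have hT : integralOperator k = B + R := by rw [hB, hR, ← integralOperator_add, sub_add_cancel]
  have hRφ : R φ = s • φ := integralOperator_rankOneKernel c φ ψ φ
  have hBφ : B φ = (lam - s) • φ := by
    rw [eq_sub_of_add_eq hT.symm, sub_apply, hφ, hRφ, sub_smul]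
  have hB0 : ∀ p, 0 ≤ (k - rankOneKernel c φ ψ) p := fun p => by
    have h1 : c * (φ p.2 * ψ p.1) ≤ c * (‖φ‖ * ‖ψ‖) :=
      mul_le_mul_of_nonneg_left (mul_le_mul ((le_abs_self _).trans (φ.norm_coe_le_norm _))
        ((le_abs_self _).trans (ψ.norm_coe_le_norm _)) (hψ0 _).le hnφ.le) hc0.le
    rw [hc, div_mul_cancel₀ m (by positivity), ← hc] at h1
    simpa [rankOneKernel] using h1.trans (hmk p)
  have hl : 0 ≤ lam - s := by
    have h := integralOperator_nonneg hB0 (fun x => (hφ0 x).le) 0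
    rw [← hB, hBφ, ContinuousMap.smul_apply, smul_eq_mul] at h
    exact nonneg_of_mul_nonneg_left h (hφ0 0)
  have hRapply : ∀ f, R f = (c * ∫ x : I, ψ x * f x) • φ :=
    integralOperator_rankOneKernel c φ ψ
  have hBR : B * R = (lam - s) • R := by
    ext1 f
    rw [mul_apply_eq_comp, smul_apply, hRapply, map_smul, hBφ,
      smul_comm]
  have hRR : R * R = s • R := by
    ext1 f
    rw [mul_apply_eq_comp, smul_apply, hRapply f, map_smul, hRφ,
      smul_comm]
  -- `R` sees `f` only through `∫ ψ f`, and by duality `∫ ψ (T f) = lam ∫ ψ f`.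
  have hRT : R * integralOperator k = lam • R := by
    ext1 f
    rw [mul_apply_eq_comp, smul_apply, hRapply, hRapply,
      integral_mul_integralOperator, hψ, smul_smul]
    simp only [ContinuousMap.smul_apply, smul_eq_mul, mul_assoc, integral_const_mul]
    rw [mul_left_comm]
  have hRB : R * B = (lam - s) • R := by
    rw [eq_sub_of_add_eq hT.symm, mul_sub, hRT, hRR]
    exact (sub_smul lam s R).symm
  by_contra! hle
  -- The spectrum of `B` lies in `|μ| ≤ lam - s < lam`.
  have hμB : μ ∉ spectrum ℝ B := fun h => by
    have := abs_le_of_mem_spectrum hB0 hl hφ0 hBφ h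
    linarith
  have hunit := isUnit_sub_add_of_rank_one hBR hRB hRR (spectrum.notMem_iff.1 hμB)
    (by rwa [sub_add_cancel])
  rw [← hT] at hunit
  exact spectrum.notMem_iff.2 hunit hμ

theorem isMaximalEigenvalue_integralOperator {k : C(I × I, ℝ)} (hk : ∀ p, 0 < k p) {lam : ℝ}
    {φ ψ : C(I, ℝ)} (hlam : 0 < lam) (hφ0 : ∀ x, 0 < φ x) (hψ0 : ∀ x, 0 < ψ x)
    (hφ : integralOperator k φ = lam • φ)
    (hψ : integralOperator (k.comp ⟨Prod.swap, continuous_swap⟩) ψ = lam • ψ) :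
    IsMaximalEigenvalue (integralOperator k) lam where
  pos := hlam
  hasEigenvalue := by
    refine Module.End.hasEigenvalue_of_hasEigenvector (x := φ)
      (Module.End.hasEigenvector_iff.2 ⟨Module.End.mem_eigenspace_iff.2 hφ, ?_⟩)
    rintro rfl
    exact (hφ0 0).false
  abs_lt _ hμ hne := abs_lt_of_mem_spectrum hk hφ0 hψ0 hφ hψ hμ hne

theorem existsUnique_isPerronData (A : C(I × I, ℝ)) (β : ℝ) :
    ∃! t : ℝ × C(I, ℝ) × C(I, ℝ), IsPerronData A β t.1 t.2.1 t.2.2 := by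
  have hk : ∀ p, 0 < gibbsKernel A β p := fun p => Real.exp_pos _
  have hk' : ∀ p, 0 < (gibbsKernel A β).comp ⟨Prod.swap, continuous_swap⟩ p :=
    fun p => Real.exp_pos _
  obtain ⟨lam, hlam, φ, hφ⟩ := exists_positive_eigenfunction hk
  obtain ⟨lam', hlam', ψ, hψ⟩ := exists_positive_eigenfunction hk'
  obtain rfl : lam = lam' := eigenvalue_eq_of_dual hφ.eigen hψ.eigen hφ.pos hψ.pos
  refine ⟨(lam, φ, ψ), ⟨?_, ?_, hφ, hψ⟩, ?_⟩
  · exact isMaximalEigenvalue_integralOperator hk hlam hφ.pos hψ.pos hφ.eigen hψ.eigen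
  · exact isMaximalEigenvalue_integralOperator hk' hlam hψ.pos hφ.pos hψ.eigen hφ.eigen
  · rintro ⟨l, φ', ψ'⟩ h
    obtain rfl : l = lam :=
      eigenvalue_eq_of_dual h.eigenfunction.eigen hψ.eigen h.eigenfunction.pos hψ.pos
    rw [positive_eigenfunction_unique hk hφ h.eigenfunction,
      positive_eigenfunction_unique hk' hψ h.eigenfunction_bar]

/-! ### Extended integrals -/

theorem extendedIntegral_congr_ae {f g : I × I → ℝ} (h : f =ᵐ[volume] g) :
    extendedIntegral f = extendedIntegral g := by
  have h1 : ∫⁻ p, ENNReal.ofReal (f p) = ∫⁻ p, ENNReal.ofReal (g p) :=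
    lintegral_congr_ae (h.mono fun p hp => by simp only [hp])
  have h2 : ∫⁻ p, ENNReal.ofReal (-f p) = ∫⁻ p, ENNReal.ofReal (-g p) :=
    lintegral_congr_ae (h.mono fun p hp => by simp only [hp])
  rw [extendedIntegral, extendedIntegral, h1, h2]

theorem extendedIntegral_of_integrable {f : I × I → ℝ} (hf : Integrable f) :
    extendedIntegral f = ((∫ p, f p : ℝ) : EReal) := by
  have h1 : ∫⁻ p, ENNReal.ofReal (f p) ≠ ⊤ := hf.lintegral_lt_top.ne
  have h2 : ∫⁻ p, ENNReal.ofReal (-f p) ≠ ⊤ := hf.neg.lintegral_lt_top.ne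
  rw [extendedIntegral, integral_eq_lintegral_pos_part_sub_lintegral_neg_part hf, EReal.coe_sub,
    EReal.coe_ennreal_toReal h1, EReal.coe_ennreal_toReal h2]

/-- The integrable minorant makes the negative part of `f` finite, so `∞ - ∞` cannot occur: either
the extended integral is `⊤` or `f` is integrable. -/
theorem integral_le_extendedIntegral {f g : I × I → ℝ} (hf : AEStronglyMeasurable f)
    (hg : Integrable g) (h : ∀ p, g p ≤ f p) : ((∫ p, g p : ℝ) : EReal) ≤ extendedIntegral f := by
  have hneg : ∫⁻ p, ENNReal.ofReal (-f p) ≠ ⊤ := by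
    refine ne_top_of_le_ne_top (hg.neg.lintegral_lt_top.ne) (lintegral_mono fun p => ?_)
    exact ENNReal.ofReal_le_ofReal (neg_le_neg (h p))
  by_cases hpos : ∫⁻ p, ENNReal.ofReal (f p) = ⊤
  · rw [extendedIntegral, hpos, ← EReal.coe_ennreal_toReal hneg, EReal.coe_ennreal_top,
      EReal.top_sub_coe]
    exact le_top
  · have hint : Integrable f := by
      refine ⟨hf, ?_⟩
      rw [hasFiniteIntegral_iff_norm]
      calc ∫⁻ p, ENNReal.ofReal ‖f p‖
          ≤ ∫⁻ p, (ENNReal.ofReal (f p) + ENNReal.ofReal (-f p)) := by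
            refine lintegral_mono fun p => ?_
            rcases le_total 0 (f p) with h0 | h0
            · rw [Real.norm_of_nonneg h0]
              exact le_self_add
            · rw [Real.norm_of_nonpos h0]
              exact le_add_self
        _ = (∫⁻ p, ENNReal.ofReal (f p)) + ∫⁻ p, ENNReal.ofReal (-f p) :=
            lintegral_add_left' hf.aemeasurable.ennreal_ofReal _
        _ < ⊤ := ENNReal.add_lt_top.2 ⟨Ne.lt_top hpos, Ne.lt_top hneg⟩
    rw [extendedIntegral_of_integrable hint]
    exact EReal.coe_le_coe_iff.2 (integral_mono hg hint h)

/-! ### Densities of disintegrated measures -/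

theorem compProd_eq_withDensity {θ : I → ℝ} {K : I → I → ℝ} (hθ : Measurable θ)
    (hθ0 : ∀ x, 0 ≤ θ x) (hK : Measurable (Function.uncurry K)) {P : Kernel I I}
    [IsMarkovKernel P] (hP : ∀ x, P x = volume.withDensity fun y => ENNReal.ofReal (K x y)) :
    (volume.withDensity fun x => ENNReal.ofReal (θ x)).compProd P =
      volume.withDensity fun p : I × I => ENNReal.ofReal (θ p.1 * K p.1 p.2) := by
  have hK' : Measurable fun p : I × I => K p.1 p.2 := hK
  ext s hs
  have hsx : ∀ x : I, MeasurableSet (Prod.mk x ⁻¹' s) := fun x => measurable_prodMk_left hs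
  rw [Measure.compProd_apply hs, lintegral_withDensity_eq_lintegral_mul _ hθ.ennreal_ofReal
    (Kernel.measurable_kernel_prodMk_left hs), withDensity_apply _ hs, ← lintegral_indicator hs,
    Measure.volume_eq_prod, lintegral_prod _ (by
      exact ((hθ.comp measurable_fst).mul hK').ennreal_ofReal.indicator hs |>.aemeasurable)]
  refine lintegral_congr fun x => ?_
  have hKx : Measurable (K x) := hK'.comp measurable_prodMk_left
  rw [Pi.mul_apply, hP, withDensity_apply _ (hsx x), ← lintegral_indicator (hsx x),
    ← lintegral_const_mul _ (hKx.ennreal_ofReal.indicator (hsx x))]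
  refine lintegral_congr fun y => ?_
  by_cases hy : (x, y) ∈ s
  · rw [Set.indicator_of_mem (show y ∈ Prod.mk x ⁻¹' s from hy), Set.indicator_of_mem hy,
      ENNReal.ofReal_mul (hθ0 x)]
  · rw [Set.indicator_of_notMem (show y ∉ Prod.mk x ⁻¹' s from hy), Set.indicator_of_notMem hy,
      mul_zero]

namespace IsContinuousDisintegration

variable {ν : Measure (I × I)} {θ : I → ℝ} {K : I → I → ℝ}

theorem measurable_density (h : IsContinuousDisintegration ν θ K) :
    Measurable fun p : I × I => θ p.1 * K p.1 p.2 :=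
  (h.theta_continuous.measurable.comp measurable_fst).mul h.k_measurable

theorem density_nonneg (h : IsContinuousDisintegration ν θ K) (p : I × I) :
    0 ≤ θ p.1 * K p.1 p.2 :=
  mul_nonneg (h.theta_nonneg _) (h.k_nonneg _ _)

theorem eq_withDensity (h : IsContinuousDisintegration ν θ K) :
    ν = volume.withDensity fun p : I × I => ENNReal.ofReal (θ p.1 * K p.1 p.2) := by
  obtain ⟨P, hP, hPK, rfl⟩ := h.disintegration
  exact compProd_eq_withDensity h.theta_continuous.measurable h.theta_nonneg h.k_measurable hPK

theorem integral_k (h : IsContinuousDisintegration ν θ K) (x : I) : ∫ y : I, K x y = 1 := by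
  obtain ⟨P, hP, hPK, -⟩ := h.disintegration
  have h1 : P x Set.univ = 1 := measure_univ
  rw [hPK, withDensity_apply _ MeasurableSet.univ, Measure.restrict_univ] at h1
  rw [integral_eq_lintegral_of_nonneg_ae (.of_forall (h.k_nonneg x))
    (h.k_continuous x).aestronglyMeasurable, h1, ENNReal.toReal_one]

theorem densityOf_ae_eq (h : IsContinuousDisintegration ν θ K) :
    densityOf ν =ᵐ[volume] fun p => θ p.1 * K p.1 p.2 := by
  have h1 := Measure.rnDeriv_withDensity (volume : Measure (I × I)) h.measurable_density.ennreal_ofReal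
  rw [← h.eq_withDensity] at h1
  filter_upwards [h1] with p hp
  rw [densityOf, hp, ENNReal.toReal_ofReal (h.density_nonneg p)]

theorem integral_densityOf_ae_eq (h : IsContinuousDisintegration ν θ K) :
    ∀ᵐ x : I, ∫ z : I, densityOf ν (x, z) = θ x := by
  filter_upwards [Measure.ae_ae_of_ae_prod h.densityOf_ae_eq] with x hx
  rw [integral_congr_ae hx, integral_const_mul, h.integral_k, mul_one]

theorem entropyTerm_eq (h : IsContinuousDisintegration ν θ K) :
    entropyTerm ν = -extendedIntegral fun p => θ p.1 * K p.1 p.2 * Real.log (K p.1 p.2) := by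
  have h1 : ∀ᵐ p : I × I, ∫ z : I, densityOf ν (p.1, z) = θ p.1 :=
    Measure.quasiMeasurePreserving_fst.ae h.integral_densityOf_ae_eq
  rw [entropyTerm, extendedIntegral_congr_ae]
  filter_upwards [h1, h.densityOf_ae_eq] with p hp1 hp2
  rw [hp1, hp2]
  -- Where `θ` vanishes the quotient is the junk value `0 / 0`, but the factor `θ K` in front is
  -- zero on both sides.
  rcases eq_or_ne (θ p.1) 0 with h0 | h0
  · simp [h0]
  · rw [mul_div_cancel_left₀ _ h0]

theorem integral_eq (h : IsContinuousDisintegration ν θ K) (f : I × I → ℝ) :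
    ∫ p, f p ∂ν = ∫ p : I × I, θ p.1 * K p.1 p.2 * f p := by
  conv_lhs => rw [h.eq_withDensity]
  rw [integral_withDensity_eq_integral_toReal_smul h.measurable_density.ennreal_ofReal
    (.of_forall fun _ => ENNReal.ofReal_lt_top)]
  refine integral_congr_ae (.of_forall fun p => ?_)
  simp only [ENNReal.toReal_ofReal (h.density_nonneg p), smul_eq_mul]

theorem integrable_density (h : IsContinuousDisintegration ν θ K) [IsFiniteMeasure ν] :
    Integrable fun p : I × I => θ p.1 * K p.1 p.2 := by
  refine ⟨h.measurable_density.aestronglyMeasurable, ?_⟩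
  rw [hasFiniteIntegral_iff_ofReal (.of_forall h.density_nonneg)]
  have h1 := measure_lt_top ν Set.univ
  rwa [h.eq_withDensity, withDensity_apply _ MeasurableSet.univ, Measure.restrict_univ] at h1

theorem integral_density (h : IsContinuousDisintegration ν θ K) [IsProbabilityMeasure ν] :
    ∫ p : I × I, θ p.1 * K p.1 p.2 = 1 := by
  simpa using (h.integral_eq fun _ => 1).symm

theorem integral_theta (h : IsContinuousDisintegration ν θ K) [IsProbabilityMeasure ν] :
    ∫ x : I, θ x = 1 := by
  have h1 := h.integral_density
  rw [Measure.volume_eq_prod, integral_prod _ h.integrable_density] at h1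
  simpa [integral_const_mul, h.integral_k] using h1

end IsContinuousDisintegration

/-! ### Stationarity -/

theorem isProbabilityMeasure_of_mem_inducedMarkov {ν : Measure (I × I)} (h : ν ∈ inducedMarkov) :
    IsProbabilityMeasure ν := by
  obtain ⟨θ, P, hθ, hP, -, rfl⟩ := h
  infer_instance

/-- Stationarity says exactly that the two marginals coincide. -/
theorem integral_snd_eq_integral_fst {ν : Measure (I × I)} (h : ν ∈ inducedMarkov) (f : C(I, ℝ)) :
    ∫ p, f p.2 ∂ν = ∫ p, f p.1 ∂ν := by
  obtain ⟨θ, P, hθ, hP, hstat, rfl⟩ := h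
  have h1 : (θ.compProd P).fst = θ := Measure.fst_compProd θ P
  have h2 : (θ.compProd P).snd = θ := by
    ext B hB
    rw [Measure.snd_compProd, Measure.bind_apply hB P.aemeasurable, hstat B hB]
  have e1 : ∫ x, f x ∂(θ.compProd P).fst = ∫ p, f p.1 ∂(θ.compProd P) :=
    integral_map measurable_fst.aemeasurable f.continuous.aestronglyMeasurable
  have e2 : ∫ x, f x ∂(θ.compProd P).snd = ∫ p, f p.2 ∂(θ.compProd P) :=
    integral_map measurable_snd.aemeasurable f.continuous.aestronglyMeasurable
  rw [← e1, ← e2, h1, h2]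

/-! ### Measures with continuous densities -/

theorem isMarkovKernel_of_integral_eq_one {K : I → I → ℝ} (hK : Continuous (Function.uncurry K))
    (hK0 : ∀ x y, 0 ≤ K x y) (hK1 : ∀ x, ∫ y : I, K x y = 1) :
    ∃ P : Kernel I I, IsMarkovKernel P ∧
      ∀ x, P x = volume.withDensity fun y => ENNReal.ofReal (K x y) := by
  have hm : Measurable (Function.uncurry fun x y => ENNReal.ofReal (K x y)) :=
    hK.measurable.ennreal_ofReal
  let P : Kernel I I := (Kernel.const I volume).withDensity fun x y => ENNReal.ofReal (K x y)
  have hP : ∀ x, P x = volume.withDensity fun y => ENNReal.ofReal (K x y) := fun x => by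
    rw [Kernel.withDensity_apply _ hm, Kernel.const_apply]
  refine ⟨P, ⟨fun x => ⟨?_⟩⟩, hP⟩
  have hKx : Continuous (K x) := hK.comp (by fun_prop : Continuous fun y : I => (x, y))
  rw [hP, withDensity_apply _ MeasurableSet.univ, Measure.restrict_univ,
    ← ofReal_integral_eq_lintegral_ofReal (integrable_of_continuous_unitInterval hKx)
      (.of_forall (hK0 x)), hK1, ENNReal.ofReal_one]

theorem withDensity_mem_inducedMarkov {θ : I → ℝ} {K : I → I → ℝ} (hθ : Continuous θ)
    (hθ0 : ∀ x, 0 ≤ θ x) (hθ1 : ∫ x : I, θ x = 1) (hK : Continuous (Function.uncurry K))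
    (hK0 : ∀ x y, 0 ≤ K x y) (hK1 : ∀ x, ∫ y : I, K x y = 1)
    (hstat : ∀ y, ∫ x : I, θ x * K x y = θ y) :
    (volume.withDensity fun p : I × I => ENNReal.ofReal (θ p.1 * K p.1 p.2)) ∈ inducedMarkov ∧
      IsContinuousDisintegration
        (volume.withDensity fun p : I × I => ENNReal.ofReal (θ p.1 * K p.1 p.2)) θ K := by
  obtain ⟨P, hP, hPK⟩ := isMarkovKernel_of_integral_eq_one hK hK0 hK1
  have heq := (compProd_eq_withDensity hθ.measurable hθ0 hK.measurable hPK).symm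
  have hKc : Continuous fun p : I × I => K p.1 p.2 := hK
  have hKx : ∀ x, Continuous (K x) := fun x =>
    hKc.comp (by fun_prop : Continuous fun y : I => (x, y))
  have hc : Continuous fun p : I × I => θ p.1 * K p.1 p.2 := by fun_prop
  refine ⟨⟨_, P, ⟨?_⟩, hP, fun B hB => ?_, heq⟩, ⟨hθ, hθ0, hK.measurable,
    hKx, hK0, P, hP, hPK, heq⟩⟩
  · rw [withDensity_apply _ MeasurableSet.univ, Measure.restrict_univ,
      ← ofReal_integral_eq_lintegral_ofReal (integrable_of_continuous_unitInterval hθ)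
      (.of_forall hθ0), hθ1, ENNReal.ofReal_one]
  · have h1 : ∀ x, (ENNReal.ofReal (θ x)) * P x B =
        ∫⁻ y in B, ENNReal.ofReal (θ x * K x y) := fun x => by
      rw [hPK, withDensity_apply _ hB, ← lintegral_const_mul _ (hKx x).measurable.ennreal_ofReal]
      simp only [ENNReal.ofReal_mul (hθ0 x)]
    rw [lintegral_withDensity_eq_lintegral_mul _ hθ.measurable.ennreal_ofReal
      (P.measurable_coe hB)]
    simp only [Pi.mul_apply, h1]
    rw [lintegral_lintegral_swap hc.measurable.ennreal_ofReal.aemeasurable,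
      withDensity_apply _ hB]
    refine lintegral_congr fun y => ?_
    have hcy : Continuous fun x => θ x * K x y :=
      hc.comp (by fun_prop : Continuous fun x : I => (x, y))
    rw [← hstat y, ofReal_integral_eq_lintegral_ofReal (integrable_of_continuous_unitInterval hcy)
      (.of_forall fun x => mul_nonneg (hθ0 x) (hK0 x y))]

/-! ### The maximizing measure -/

theorem continuous_thetaBeta (φ ψ : C(I, ℝ)) : Continuous (thetaBeta φ ψ) := by
  unfold thetaBeta
  fun_prop

namespace IsPerronData

variable {A : C(I × I, ℝ)} {β lam : ℝ} {φ ψ : C(I, ℝ)}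

theorem lam_pos (h : IsPerronData A β lam φ ψ) : 0 < lam := h.maximal.pos

theorem integral_pos (h : IsPerronData A β lam φ ψ) : 0 < ∫ z : I, φ z * ψ z :=
  integral_mul_pos h.eigenfunction.pos h.eigenfunction_bar.pos

theorem thetaBeta_nonneg (h : IsPerronData A β lam φ ψ) (x : I) : 0 ≤ thetaBeta φ ψ x :=
  div_nonneg (mul_pos (h.eigenfunction.pos x) (h.eigenfunction_bar.pos x)).le h.integral_pos.le

theorem integral_thetaBeta (h : IsPerronData A β lam φ ψ) : ∫ x : I, thetaBeta φ ψ x = 1 := by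
  simp only [thetaBeta]
  rw [integral_div, div_self h.integral_pos.ne']

theorem continuous_kBeta (h : IsPerronData A β lam φ ψ) :
    Continuous (Function.uncurry (kBeta A β lam ψ)) := by
  have hne : ∀ p : I × I, ψ p.1 * lam ≠ 0 := fun p =>
    (mul_pos (h.eigenfunction_bar.pos _) h.lam_pos).ne'
  have : Function.uncurry (kBeta A β lam ψ) =
      fun p : I × I => Real.exp (β * A p) * ψ p.2 / (ψ p.1 * lam) := rfl
  rw [this]
  exact Continuous.div (by fun_prop) (by fun_prop) hne

theorem kBeta_pos (h : IsPerronData A β lam φ ψ) (x y : I) : 0 < kBeta A β lam ψ x y :=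
  div_pos (mul_pos (Real.exp_pos _) (h.eigenfunction_bar.pos y))
    (mul_pos (h.eigenfunction_bar.pos x) h.lam_pos)

theorem integral_kBeta (h : IsPerronData A β lam φ ψ) (x : I) :
    ∫ y : I, kBeta A β lam ψ x y = 1 := by
  have h1 : perronOpBar A β ψ x = lam * ψ x := by rw [h.eigenfunction_bar.eigen]; rfl
  rw [perronOpBar_apply] at h1
  simp only [kBeta]
  rw [integral_div, h1, mul_comm, div_self (mul_pos (h.eigenfunction_bar.pos x) h.lam_pos).ne']

/-- The factor `ψ(x)` cancels, leaving the eigenvalue equation for `φ` at `y`, multiplied by `ψ(y)`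
and a constant. -/
theorem integral_thetaBeta_mul_kBeta (h : IsPerronData A β lam φ ψ) (y : I) :
    ∫ x : I, thetaBeta φ ψ x * kBeta A β lam ψ x y = thetaBeta φ ψ y := by
  have h1 : perronOp A β φ y = lam * φ y := by rw [h.eigenfunction.eigen]; rfl
  rw [perronOp_apply] at h1
  have hlam := h.lam_pos.ne'
  have hint := h.integral_pos.ne'
  have h2 : ∀ x, thetaBeta φ ψ x * kBeta A β lam ψ x y =
      Real.exp (β * A (x, y)) * φ x * (ψ y / (lam * ∫ z : I, φ z * ψ z)) := fun x => by
    have hψ := (h.eigenfunction_bar.pos x).ne'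
    simp only [thetaBeta, kBeta]
    field_simp
  simp only [h2]
  rw [integral_mul_const, h1, thetaBeta]
  field_simp

theorem log_kBeta (h : IsPerronData A β lam φ ψ) (x y : I) :
    Real.log (kBeta A β lam ψ x y) =
      β * A (x, y) + Real.log (ψ y) - Real.log (ψ x) - Real.log lam := by
  have hy := (h.eigenfunction_bar.pos y).ne'
  have hx := (h.eigenfunction_bar.pos x).ne'
  have hlam := h.lam_pos.ne'
  rw [kBeta, Real.log_div (mul_ne_zero (Real.exp_pos _).ne' hy) (mul_ne_zero hx hlam),
    Real.log_mul (Real.exp_pos _).ne' hy, Real.log_mul hx hlam, Real.log_exp]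
  ring

theorem continuous_log_kBeta (h : IsPerronData A β lam φ ψ) :
    Continuous fun p : I × I => Real.log (kBeta A β lam ψ p.1 p.2) :=
  h.continuous_kBeta.log fun p => (h.kBeta_pos p.1 p.2).ne'

theorem nuBeta_spec (h : IsPerronData A β lam φ ψ) :
    nuBeta A β lam φ ψ ∈ inducedMarkov ∧
      IsContinuousDisintegration (nuBeta A β lam φ ψ) (thetaBeta φ ψ) (kBeta A β lam ψ) :=
  withDensity_mem_inducedMarkov (continuous_thetaBeta φ ψ) h.thetaBeta_nonneg h.integral_thetaBeta
    h.continuous_kBeta (fun x y => (h.kBeta_pos x y).le) h.integral_kBeta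
    h.integral_thetaBeta_mul_kBeta

theorem nuBeta_mem (h : IsPerronData A β lam φ ψ) : nuBeta A β lam φ ψ ∈ inducedMarkovAC :=
  ⟨h.nuBeta_spec.1, _, _, h.nuBeta_spec.2⟩

theorem integral_log_kBeta (h : IsPerronData A β lam φ ψ) {ν : Measure (I × I)}
    (hν : ν ∈ inducedMarkov) :
    ∫ p, Real.log (kBeta A β lam ψ p.1 p.2) ∂ν = ∫ p, β * A p ∂ν - Real.log lam := by
  have := isProbabilityMeasure_of_mem_inducedMarkov hν
  have hint : ∀ {f : I × I → ℝ}, Continuous f → Integrable f ν := fun {f} hf => by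
    have h := hf.continuousOn.integrableOn_compact (μ := ν) isCompact_univ
    simpa using h
  let g : C(I, ℝ) := ⟨fun x => Real.log (ψ x),
    ψ.continuous.log fun x => (h.eigenfunction_bar.pos x).ne'⟩
  have hg : ∫ p, g p.2 ∂ν = ∫ p, g p.1 ∂ν := integral_snd_eq_integral_fst hν g
  have hlog : ∀ p : I × I, Real.log (kBeta A β lam ψ p.1 p.2) =
      β * A p + g p.2 - g p.1 - Real.log lam := fun p => h.log_kBeta p.1 p.2
  simp only [hlog]
  rw [integral_sub (hint (by fun_prop)) (hint (by fun_prop)),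
    integral_sub (hint (by fun_prop)) (hint (by fun_prop)),
    integral_add (hint (by fun_prop)) (hint (by fun_prop)), hg]
  simp

theorem penalizedFunctional_nuBeta (h : IsPerronData A β lam φ ψ) :
    penalizedFunctional A β (nuBeta A β lam φ ψ) = (Real.log lam : EReal) := by
  obtain ⟨hν, hd⟩ := h.nuBeta_spec
  have hθ := continuous_thetaBeta φ ψ
  have hlog := h.continuous_log_kBeta
  have hk : Continuous fun p : I × I => kBeta A β lam ψ p.1 p.2 := h.continuous_kBeta
  have hint : Integrable fun p : I × I => thetaBeta φ ψ p.1 * kBeta A β lam ψ p.1 p.2 *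
      Real.log (kBeta A β lam ψ p.1 p.2) :=
    integrable_of_continuous_unitSquare (by fun_prop)
  rw [penalizedFunctional, hd.entropyTerm_eq, extendedIntegral_of_integrable hint,
    ← hd.integral_eq, h.integral_log_kBeta hν, ← EReal.coe_neg, ← EReal.coe_add]
  congr 1
  ring

theorem penalizedFunctional_le (h : IsPerronData A β lam φ ψ) {ν : Measure (I × I)}
    (hν : ν ∈ inducedMarkovAC) : penalizedFunctional A β ν ≤ (Real.log lam : EReal) := by
  obtain ⟨hν, θ, K, hd⟩ := hν
  have := isProbabilityMeasure_of_mem_inducedMarkov hν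
  have hθc := hd.theta_continuous
  have hk : Continuous fun p : I × I => kBeta A β lam ψ p.1 p.2 := h.continuous_kBeta
  have hlogc := h.continuous_log_kBeta
  -- `θ K` is only known to be integrable, so `log K_β` must be bounded for their product to be.
  obtain ⟨M, hM⟩ := (isCompact_univ.bddAbove_image hlogc.norm.continuousOn)
  have hM' : ∀ p : I × I, ‖Real.log (kBeta A β lam ψ p.1 p.2)‖ ≤ M := fun p =>
    hM ⟨p, trivial, rfl⟩
  have hi1 : Integrable fun p : I × I =>
      θ p.1 * K p.1 p.2 * Real.log (kBeta A β lam ψ p.1 p.2) :=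
    hd.integrable_density.mul_bdd hlogc.aestronglyMeasurable (.of_forall hM')
  have hi2 : Integrable fun p : I × I => θ p.1 * kBeta A β lam ψ p.1 p.2 :=
    integrable_of_continuous_unitSquare (by fun_prop)
  have hi3 := hd.integrable_density
  have hi4 : Integrable fun p : I × I =>
      θ p.1 * K p.1 p.2 - θ p.1 * kBeta A β lam ψ p.1 p.2 := hi3.sub hi2
  -- Pointwise Gibbs inequality, from `log t ≤ t - 1` at `t = K_β / K`. The correction `θ K - θ K_β`
  -- integrates to `1 - 1 = 0`. Where `K = 0`, the convention `0 log 0 = 0` leaves `-θ K_β ≤ 0`.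
  have hpt : ∀ p : I × I, θ p.1 * K p.1 p.2 * Real.log (kBeta A β lam ψ p.1 p.2) +
      (θ p.1 * K p.1 p.2 - θ p.1 * kBeta A β lam ψ p.1 p.2) ≤
        θ p.1 * K p.1 p.2 * Real.log (K p.1 p.2) := fun p => by
    have hkp := h.kBeta_pos p.1 p.2
    have key : K p.1 p.2 * Real.log (kBeta A β lam ψ p.1 p.2) +
        (K p.1 p.2 - kBeta A β lam ψ p.1 p.2) ≤ K p.1 p.2 * Real.log (K p.1 p.2) := by
      rcases (hd.k_nonneg p.1 p.2).eq_or_lt with h0 | h0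
      · rw [← h0]
        simpa using hkp.le
      · have h1 := Real.log_le_sub_one_of_pos (div_pos hkp h0)
        rw [Real.log_div hkp.ne' h0.ne'] at h1
        have h2 := mul_le_mul_of_nonneg_left h1 h0.le
        rw [mul_sub, mul_sub, mul_div_cancel₀ _ h0.ne'] at h2
        linarith
    have h3 := mul_le_mul_of_nonneg_left key (hd.theta_nonneg p.1)
    linarith
  have hmeas : AEStronglyMeasurable fun p : I × I =>
      θ p.1 * K p.1 p.2 * Real.log (K p.1 p.2) :=
    (hd.measurable_density.mul hd.k_measurable.log).aestronglyMeasurable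
  have hle := integral_le_extendedIntegral hmeas (hi1.add hi4) hpt
  have hval : ∫ p : I × I, θ p.1 * kBeta A β lam ψ p.1 p.2 = 1 := by
    rw [Measure.volume_eq_prod, integral_prod _ hi2]
    simp only [integral_const_mul, h.integral_kBeta, mul_one, hd.integral_theta]
  have hsum : ∫ p : I × I, (θ p.1 * K p.1 p.2 * Real.log (kBeta A β lam ψ p.1 p.2) +
      (θ p.1 * K p.1 p.2 - θ p.1 * kBeta A β lam ψ p.1 p.2)) =
        ∫ p, β * A p ∂ν - Real.log lam := by
    rw [integral_add hi1 hi4, integral_sub hi3 hi2, hval, hd.integral_density,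
      ← hd.integral_eq, h.integral_log_kBeta hν]
    ring
  have hle' : ((∫ p, β * A p ∂ν - Real.log lam : ℝ) : EReal) ≤
      extendedIntegral fun p => θ p.1 * K p.1 p.2 * Real.log (K p.1 p.2) := by
    rw [← hsum]
    exact hle
  rw [penalizedFunctional, hd.entropyTerm_eq]
  calc _ ≤ ((∫ p, β * A p ∂ν : ℝ) : EReal) + -((∫ p, β * A p ∂ν - Real.log lam : ℝ) : EReal) :=
        add_le_add le_rfl (EReal.neg_le_neg_iff.2 hle')
    _ = _ := by
        rw [← EReal.coe_neg, ← EReal.coe_add]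
        congr 1
        ring

end IsPerronData

theorem proposition2 (A : C(I × I, ℝ)) (β : ℝ) :
    -- the objects `λ_β`, `φ_β`, `φ̄_β` exist and are unique
    (∃! t : ℝ × C(I, ℝ) × C(I, ℝ), IsPerronData A β t.1 t.2.1 t.2.2) ∧
    -- on `M_ac` the entropy `S[θ K]` is `- ∫ θ K log K`
    (∀ ν ∈ inducedMarkovAC, ∀ (θ : I → ℝ) (K : I → I → ℝ), IsContinuousDisintegration ν θ K →
      entropyTerm ν = -extendedIntegral fun p => θ p.1 * K p.1 p.2 * Real.log (K p.1 p.2)) ∧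
    ∀ (lam : ℝ) (φ ψ : C(I, ℝ)), IsPerronData A β lam φ ψ →
      -- `ν_β = θ_β K_β` belongs to `M_ac`
      (nuBeta A β lam φ ψ ∈ inducedMarkovAC ∧
        IsContinuousDisintegration (nuBeta A β lam φ ψ) (thetaBeta φ ψ) (kBeta A β lam ψ) ∧
        Continuous (Function.uncurry (kBeta A β lam ψ))) ∧
      -- it maximizes the functional over `M_ac`
      (∀ ν ∈ inducedMarkovAC,
        penalizedFunctional A β ν ≤ penalizedFunctional A β (nuBeta A β lam φ ψ)) ∧
      -- and the maximum is `log λ_β`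
      penalizedFunctional A β (nuBeta A β lam φ ψ) = (Real.log lam : EReal) := by
  refine ⟨existsUnique_isPerronData A β, fun ν _ θ K hd => hd.entropyTerm_eq,
    fun lam φ ψ h => ⟨⟨h.nuBeta_mem, h.nuBeta_spec.2, h.continuous_kBeta⟩, fun ν hν => ?_,
      h.penalizedFunctional_nuBeta⟩⟩
  rw [h.penalizedFunctional_nuBeta]
  exact h.penalizedFunctional_le hν
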